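/- For every $n\ge 1$ there is a pair $A,B$ of real $n\times n$ matrices such that the semigroup $\langle A,B\rangle$ generated by $A$ and $B$ under multiplication is dense in the space $\mathcal M_{n\times n}(\mathbb R)$ of all real $n\times n$ matrices. Moreover, if $n\ge 3$, such a pair can be chosen so that $A$ belongs to $\mathcal R_n$. Here, for $n\ge 2$, $\mathcal R_n$ is the set of all invertible real $n\times n$ matrices $A$ that are similar over $\mathbb R$ to a block-diagonal matrix $\mathrm{diag}(Z_1,Z_2,\dots,Z_k)$, $k\ge 2$, such that: (i) $Z_1$ is a positive real number; (ii) $Z_k$ is the number $|\det A|/\det A$; (iii) for $1<i<k$, either $Z_i=1$ or $Z_i$ is a $2\times 2$ block $$\begin{pmatrix}\cos(2^{-m}\pi) & -\sin(2^{-m}\pi)\\ \sin(2^{-m}\pi) & \cos(2^{-m}\pi)\end{pmatrix}$$ for some integer $m\ge 0$ (depending on $i$); (iv) $A$ has at least one eigenvalue equal to $1$. -/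

import Mathlib

open Matrix

/-- The blocks allowed strictly between the first and the last diagonal block: the `1 × 1` block `1`,
or the `2 × 2` rotation by the angle `2⁻ᵐ π`, with `m = 0, 1, 2, …`. -/
inductive MiddleBlock : Type
  | one : MiddleBlock
  | rot (m : ℕ) : MiddleBlock

namespace MiddleBlock

/-- The size of a middle block. -/
def size : MiddleBlock → ℕ
  | one => 1
  | rot _ => 2

/-- The matrix of a middle block. -/
noncomputable def toMatrix : (b : MiddleBlock) → Matrix (Fin b.size) (Fin b.size) ℝ
  | one => (1 : Matrix (Fin 1) (Fin 1) ℝ)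
  | rot m =>
    (!![Real.cos (Real.pi / 2 ^ m), -Real.sin (Real.pi / 2 ^ m);
        Real.sin (Real.pi / 2 ^ m), Real.cos (Real.pi / 2 ^ m)] : Matrix (Fin 2) (Fin 2) ℝ)

end MiddleBlock

/-- The index type of a block-diagonal matrix with a `1 × 1` first block, the `p` middle blocks
`L 0, …, L (p - 1)`, and a `1 × 1` last block. -/
abbrev BlockIndex {p : ℕ} (L : Fin p → MiddleBlock) : Type :=
  Unit ⊕ ((i : Fin p) × Fin (L i).size) ⊕ Unit

/-- The block-diagonal matrix `diag(z, L 0, …, L (p - 1), s)`. -/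
noncomputable def blockForm {p : ℕ} (z : ℝ) (L : Fin p → MiddleBlock) (s : ℝ) :
    Matrix (BlockIndex L) (BlockIndex L) ℝ :=
  Matrix.fromBlocks (Matrix.of fun _ _ => z) 0 0
    (Matrix.fromBlocks (Matrix.blockDiagonal' fun i => (L i).toMatrix) 0 0
      (Matrix.of fun _ _ => s))

/-- The class of real `n × n` matrices `A` (with `n ≥ 2`) that are similar over `ℝ` to a matrix
`diag(Z₁, Z₂, …, Z_k)` where `Z₁` is a positive number, every middle block is `1` or a rotation by
`2⁻ᵐ π`, and `Z_k = |det A| / det A`, and that have the eigenvalue `1`. The quotient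
`|det A| / det A` presupposes `det A ≠ 0`. -/
def rotationClass (n : ℕ) : Set (Matrix (Fin n) (Fin n) ℝ) :=
  {A | A.det ≠ 0 ∧
    (∃ (p : ℕ) (z : ℝ) (L : Fin p → MiddleBlock) (e : BlockIndex L ≃ Fin n)
        (P : Matrix (Fin n) (Fin n) ℝ),
      0 < z ∧ IsUnit P.det ∧
        A = P * Matrix.reindex e e (blockForm z L (|A.det| / A.det)) * P⁻¹) ∧
    Module.End.HasEigenvalue (Matrix.toLin' A) 1}

/-! In the plane, let D = diag(2, 1) and B = (1/3) R(θ). For generic θ, the closure of the semigroup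
generated by D and B contains every similarity r R(φ) with r > 0. By Baire's theorem it is enough
that, for each basic open U meeting these similarities, the angles θ for which some word D^a B^k D^a
B^l lies in U form a dense open set; at dyadic angles such words can be computed
(`exists_angle_similarities_mem_closure`). Conjugating small rotations by powers of D gives
transvections in the limit, and these give diag(x, 1). Gaussian elimination builds every matrix from
transvections, positive dilations and one reflection (`mem_of_transvection_mem`).

For n ≥ 3, A is diag(√2, 1, …, 1) times the swap of coordinates 2 and 3, and B is a planar
similarity times a cyclic permutation of the coordinates after the second. A² and a power of B are
the planar pair above. The planar factors can then be cancelled from A and B, leaving permutations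
that spread the planar transvections to all coordinates (`exists_dense_pair_dilationSwap`). Since A
is similar to diag(√2, 1, …, 1, -1), it lies in `rotationClass`. Dimensions 1 and 2 use explicit
variants. -/

open Filter Topology

/-! ### Diophantine approximation and dyadic angles -/

/-- If `X / Y` is irrational, the numbers `a X - l Y` with natural `a`, `l` are dense in `ℝ`. -/
theorem exists_nat_mul_sub_nat_mul_near {X Y : ℝ} (hX : 0 < X) (hY : 0 < Y)
    (h : Irrational (X / Y)) (t ε : ℝ) (hε : 0 < ε) :
    ∃ a l : ℕ, |a * X - l * Y - t| < ε := by
  have : Fact (0 < Y) := ⟨hY⟩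
  -- Shifting the target below -ε forces y < 0, so that l Y = b X - y is positive and l is a natural
  -- number.
  obtain ⟨a₀, ha₀⟩ := exists_nat_gt ((t + ε) / X)
  rw [div_lt_iff₀ hX] at ha₀
  have hd : DenseRange (fun n : ℕ => n • (X : AddCircle Y)) := by
    rw [← denseRange_zsmul_iff_nsmul]
    exact AddCircle.denseRange_zsmul_coe_iff.2 h
  obtain ⟨b, hb⟩ := hd.exists_mem_open
    (QuotientAddGroup.isOpenMap_coe (N := AddSubgroup.zmultiples Y) _
      (Metric.isOpen_ball (x := t - a₀ * X) (ε := ε)))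
    ⟨_, Set.mem_image_of_mem _ (Metric.mem_ball_self hε)⟩
  obtain ⟨y, hy, hyb⟩ := hb
  change (y : AddCircle Y) = b • (X : AddCircle Y) at hyb
  have : ((b * X - y : ℝ) : AddCircle Y) = 0 := by
    have h2 : ((b * X : ℝ) : AddCircle Y) = (y : AddCircle Y) := by
      rw [hyb]; simp [← nsmul_eq_mul]
    rw [AddCircle.coe_sub, h2, sub_self]
  obtain ⟨l, hl⟩ := AddCircle.coe_eq_zero_iff _ |>.1 this
  rw [zsmul_eq_mul] at hl
  rw [Metric.mem_ball, Real.dist_eq, abs_lt] at hy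
  have hb0 : 0 ≤ (b : ℝ) * X := by positivity
  have hl0 : 0 ≤ l := by
    by_contra hneg
    have : (l : ℝ) ≤ 0 := by exact_mod_cast (not_le.1 hneg).le
    nlinarith [mul_nonneg (neg_nonneg.2 this) hY.le]
  obtain ⟨k, rfl⟩ := Int.eq_ofNat_of_zero_le hl0
  refine ⟨a₀ + b, k, ?_⟩
  push_cast at hl ⊢
  rw [abs_lt]
  constructor <;> nlinarith

/-- A rational value would give 3^p = 2^q with q > 0, against parity. -/
theorem irrational_log_two_div_log_three : Irrational (Real.log 2 / Real.log 3) := by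
  rintro ⟨q, hq⟩
  have h2 : 0 < Real.log 2 := Real.log_pos (by norm_num)
  have h3 : 0 < Real.log 3 := Real.log_pos (by norm_num)
  have hq0 : 0 < q := by
    have : (0 : ℝ) < q := hq ▸ div_pos h2 h3
    exact_mod_cast this
  have hnum : ((q.num.toNat : ℕ) : ℤ) = q.num := Int.toNat_of_nonneg (Rat.num_pos.2 hq0).le
  have hq' : (q : ℝ) = (q.num.toNat : ℝ) / q.den := by
    have : ((q.num.toNat : ℕ) : ℝ) = (q.num : ℝ) := by exact_mod_cast congrArg (Int.cast (R := ℝ)) hnum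
    rw [this, ← Rat.cast_def]
  have hden : (0 : ℝ) < q.den := by exact_mod_cast q.den_pos
  rw [hq', div_eq_div_iff hden.ne' h3.ne', mul_comm (Real.log 2), ← Real.log_pow, ← Real.log_pow] at hq
  have := Real.log_injOn_pos (by simp : (3 : ℝ) ^ q.num.toNat ∈ Set.Ioi (0 : ℝ)) (by simp : (2 : ℝ) ^ q.den ∈ Set.Ioi (0 : ℝ)) hq
  have h' : 3 ^ q.num.toNat = 2 ^ q.den := by exact_mod_cast this
  have ho : Odd (3 ^ q.num.toNat) := Odd.pow (by decide)
  have he : Even (2 ^ q.den) := (Nat.even_pow.2 ⟨even_two, q.den_pos.ne'⟩)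
  rw [h'] at ho
  exact (Nat.not_even_iff_odd.2 ho) he

/-- The numbers `C 2 ^ a (3⁻¹) ^ (Q l)` are dense in the positive half-line. -/
theorem exists_two_pow_mul_inv_three_pow_mem {C : ℝ} (hC : 0 < C) {Q : ℕ} (hQ : 0 < Q) {r : ℝ}
    (hr : 0 < r) {U : Set ℝ} (hU : U ∈ 𝓝 r) :
    ∃ a l : ℕ, C * (2 ^ a * (3⁻¹ : ℝ) ^ (Q * l)) ∈ U := by
  have h2 : 0 < Real.log 2 := Real.log_pos (by norm_num)
  have h3 : 0 < Real.log 3 := Real.log_pos (by norm_num)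
  have hc : ContinuousAt (fun t => C * Real.exp t) (Real.log (r / C)) := by fun_prop
  have hU' : U ∈ 𝓝 (C * Real.exp (Real.log (r / C))) := by
    rwa [Real.exp_log (div_pos hr hC), mul_div_cancel₀ _ hC.ne']
  obtain ⟨ε, hε, hsub⟩ := Metric.mem_nhds_iff.1 (hc hU')
  have hirr : Irrational (Real.log 2 / (Q * Real.log 3)) := by
    rw [mul_comm, ← div_div]
    exact irrational_log_two_div_log_three.div_natCast hQ.ne'
  obtain ⟨a, l, h⟩ := exists_nat_mul_sub_nat_mul_near h2 (mul_pos (Nat.cast_pos.2 hQ) h3)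
    hirr (Real.log (r / C)) ε hε
  refine ⟨a, l, ?_⟩
  have := hsub (by rwa [Metric.mem_ball, Real.dist_eq] : (a * Real.log 2 - l * (Q * Real.log 3)) ∈ _)
  rw [Set.mem_preimage, Real.exp_sub, ← mul_assoc, Real.exp_nat_mul, Real.exp_log two_pos, mul_comm (l : ℝ) Q,
    ← Nat.cast_mul, Real.exp_nat_mul, Real.exp_log three_pos, div_eq_mul_inv] at this
  rwa [inv_pow]

/-- Odd multiples of π / 2^s are 2π / 2^s apart, so the error is at most π / 2^s. Oddness makes the
numerator invertible modulo powers of 2. -/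
theorem tendsto_odd_dyadic (x : ℝ) :
    Tendsto (fun s : ℕ => Real.pi * (2 * ⌊x * 2 ^ s / (2 * Real.pi)⌋ + 1 : ℤ) / 2 ^ s) atTop (𝓝 x) := by
  have hpi := Real.pi_pos
  have hz : Tendsto (fun s : ℕ => Real.pi * (2⁻¹ : ℝ) ^ s) atTop (𝓝 0) := by
    simpa using (tendsto_pow_atTop_nhds_zero_of_lt_one (by norm_num : (0:ℝ) ≤ 2⁻¹)
      (by norm_num)).const_mul Real.pi
  refine tendsto_iff_dist_tendsto_zero.2 (squeeze_zero (fun _ => dist_nonneg) (fun s => ?_) hz)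
  have h1 := Int.floor_le (x * 2 ^ s / (2 * Real.pi))
  have h2 := Int.lt_floor_add_one (x * 2 ^ s / (2 * Real.pi))
  rw [le_div_iff₀ (by positivity)] at h1
  rw [div_lt_iff₀ (by positivity)] at h2
  have hp : (0 : ℝ) < 2 ^ s := by positivity
  rw [Real.dist_eq, inv_pow, ← div_eq_mul_inv,
    show ∀ y : ℝ, y / 2 ^ s - x = (y - x * 2 ^ s) / 2 ^ s from fun y => by field_simp,
    abs_div, abs_of_pos hp]
  gcongr
  rw [abs_le]
  push_cast
  constructor <;> nlinarith

/-- An odd p is a unit modulo 2^s. The multiplier is k + 1 because a semigroup offers only positive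
powers. -/
theorem exists_nat_mul_odd_emod {p : ℤ} (hp : Odd p) (s : ℕ) (j : ℤ) :
    ∃ k : ℕ, ∃ c : ℤ, ((k + 1 : ℕ) : ℤ) * p = j + c * 2 ^ s := by
  have hco : IsCoprime p (2 ^ s) := (Int.isCoprime_iff_gcd_eq_one.2 (by
    rw [Int.gcd_comm]
    exact Int.isCoprime_iff_gcd_eq_one.1 ((Int.isCoprime_two_left).2 hp))).pow_right
  obtain ⟨u, v, huv⟩ := hco
  have hpos : (0 : ℤ) < 2 ^ s := by positivity
  have hk : 0 ≤ (j * u - 1) % 2 ^ s := Int.emod_nonneg _ hpos.ne'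
  refine ⟨((j * u - 1) % 2 ^ s).toNat, -(j * v) - (j * u - 1) / 2 ^ s * p, ?_⟩
  push_cast
  rw [Int.toNat_of_nonneg hk]
  have := Int.emod_add_mul_ediv (j * u - 1) (2 ^ s)
  linear_combination p * this + j * huv

theorem Subsemigroup.pow_succ_mem {M : Type*} [Monoid M] (S : Subsemigroup M) {x : M} (hx : x ∈ S)
    (k : ℕ) : x ^ (k + 1) ∈ S := by
  induction k with
  | zero => simpa using hx
  | succ k ih => rw [pow_succ]; exact S.mul_mem ih hx

/-! ### Planar rotations and the generic angle -/

/-- The rotation of the plane by the angle `φ`. -/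
noncomputable def planeRotation (φ : ℝ) : Matrix (Fin 2) (Fin 2) ℝ :=
  !![Real.cos φ, -Real.sin φ; Real.sin φ, Real.cos φ]

theorem planeRotation_zero : planeRotation 0 = 1 := by
  simp [planeRotation, Matrix.one_fin_two]

theorem planeRotation_mul (a b : ℝ) :
    planeRotation a * planeRotation b = planeRotation (a + b) := by
  ext i j
  fin_cases i <;> fin_cases j <;>
    simp [planeRotation, Matrix.mul_apply, Fin.sum_univ_two, Real.cos_add, Real.sin_add] <;> ring

theorem planeRotation_pow (a : ℝ) (k : ℕ) : planeRotation a ^ k = planeRotation (k * a) := by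
  induction k with
  | zero => simp [planeRotation_zero]
  | succ k ih => rw [pow_succ, ih, planeRotation_mul]; push_cast; ring_nf

theorem planeRotation_add_int_mul_two_pi (a : ℝ) (c : ℤ) :
    planeRotation (a + c * (2 * Real.pi)) = planeRotation a := by
  simp [planeRotation, Real.cos_add_int_mul_two_pi, Real.sin_add_int_mul_two_pi]

theorem planeRotation_pi_div_two : planeRotation (Real.pi / 2) = !![0, -1; 1, 0] := by
  simp [planeRotation]

theorem planeRotation_neg_pi_div_two : planeRotation (-(Real.pi / 2)) = !![0, 1; -1, 0] := by
  simp [planeRotation]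

@[fun_prop]
theorem continuous_planeRotation : Continuous planeRotation := by
  refine continuous_matrix fun i j => ?_
  fin_cases i <;> fin_cases j <;> simp [planeRotation] <;> fun_prop

theorem diagonal_fin_two_pow (z w : ℝ) (k : ℕ) :
    (diagonal ![z, w]) ^ k = diagonal ![z ^ k, w ^ k] := by
  rw [diagonal_pow]
  congr 1
  ext i
  fin_cases i <;> simp

/-- Conjugation by a quarter turn exchanges the axes, so the product is diag(z, 1) diag(1, z). This
is how homotheties arise from dilations of one axis. -/
theorem diagonal_mul_quarter_turn_conj (z : ℝ) :
    diagonal ![z, 1] * planeRotation (Real.pi / 2) * diagonal ![z, 1] *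
      planeRotation (-(Real.pi / 2)) = z • (1 : Matrix (Fin 2) (Fin 2) ℝ) := by
  rw [planeRotation_pi_div_two, planeRotation_neg_pi_div_two]
  ext i j
  fin_cases i <;> fin_cases j <;> simp [Matrix.mul_apply, Fin.sum_univ_two]

theorem planeRotation_dyadic_eq {p j c : ℤ} {k s : ℕ} (h : (k : ℤ) * p = j + c * 2 ^ (s + 1)) :
    planeRotation (k * (Real.pi * p / 2 ^ s)) = planeRotation (Real.pi * j / 2 ^ s) := by
  rw [← planeRotation_add_int_mul_two_pi (Real.pi * j / 2 ^ s) c]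
  congr 1
  have h' : (k : ℝ) * p = j + c * 2 ^ (s + 1) := by exact_mod_cast h
  rw [show (k : ℝ) * (Real.pi * p / 2 ^ s) = Real.pi * (k * p) / 2 ^ s by ring, h']
  rw [pow_succ]
  field_simp

/-- For a suitable angle `θ`, the closure of the semigroup generated by `diag(2, 1)` and the
rotation by `θ` scaled by `1/3` contains all similarities of the plane that preserve orientation. -/
theorem exists_angle_similarities_mem_closure :
    ∃ θ : ℝ, ∀ r φ : ℝ, 0 < r → r • planeRotation φ ∈
      closure (Subsemigroup.closure {diagonal ![2, 1], (3⁻¹ : ℝ) • planeRotation θ} :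
        Set (Matrix (Fin 2) (Fin 2) ℝ)) := by
  have : SecondCountableTopology (Matrix (Fin 2) (Fin 2) ℝ) :=
    inferInstanceAs (SecondCountableTopology (Fin 2 → Fin 2 → ℝ))
  set W : ℕ → ℕ → ℕ → ℝ → Matrix (Fin 2) (Fin 2) ℝ := fun a k l θ =>
    diagonal ![2, 1] ^ (a + 1) * ((3⁻¹ : ℝ) • planeRotation θ) ^ (k + 1) *
      diagonal ![2, 1] ^ (a + 1) * ((3⁻¹ : ℝ) • planeRotation θ) ^ (l + 1) with hW
  have hWc : ∀ a k l, Continuous (W a k l) := fun a k l => by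
    simp only [hW]; fun_prop
  let b := TopologicalSpace.countableBasis (Matrix (Fin 2) (Fin 2) ℝ)
  have hb := TopologicalSpace.isBasis_countableBasis (Matrix (Fin 2) (Fin 2) ℝ)
  let I := {U ∈ b | ∃ r φ : ℝ, 0 < r ∧ r • planeRotation φ ∈ U}
  let O : Set (Matrix (Fin 2) (Fin 2) ℝ) → Set ℝ := fun U => ⋃ (a) (k) (l), W a k l ⁻¹' U
  have hO : ∀ U ∈ I, IsOpen (O U) := fun U hU =>
    isOpen_iUnion fun a => isOpen_iUnion fun k => isOpen_iUnion fun l =>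
      (hb.isOpen hU.1).preimage (hWc a k l)
  have hcount : I.Countable := (TopologicalSpace.countable_countableBasis _).mono fun U h => h.1
  have hdense : ∀ U ∈ I, Dense (O U) := by
    rintro U ⟨hUb, r, φ, hr, hrφ⟩
    have hUo := hb.isOpen hUb
    rw [dense_iff_inter_open]
    rintro V hV ⟨θ₀, hθ₀⟩
    have hφ : ∀ᶠ x in 𝓝 φ, r • planeRotation x ∈ U :=
      (Continuous.continuousAt (f := fun x => r • planeRotation x) (by fun_prop)).eventually
        (hUo.mem_nhds hrφ)
    obtain ⟨s, hs1, hs2, hs3⟩ := (((tendsto_odd_dyadic θ₀).eventually (hV.mem_nhds hθ₀)).and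
      (((tendsto_odd_dyadic φ).eventually hφ).and (eventually_ge_atTop 1))).exists
    set p : ℤ := 2 * ⌊θ₀ * 2 ^ s / (2 * Real.pi)⌋ + 1 with hp
    set j : ℤ := 2 * ⌊φ * 2 ^ s / (2 * Real.pi)⌋ + 1 with hj
    have hpodd : Odd p := ⟨_, hp⟩
    obtain ⟨s, rfl⟩ := Nat.exists_eq_add_of_le' hs3
    -- With θ = π p / 2^(s+1), the power k + 1 is a quarter turn and the power l + 1 is the inverse
    -- quarter turn followed by the dyadic angle near φ.
    obtain ⟨k, c, hk⟩ := exists_nat_mul_odd_emod hpodd (s + 1 + 1) (2 ^ s)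
    obtain ⟨l, d, hl⟩ := exists_nat_mul_odd_emod hpodd (s + 1 + 1) (j - 2 ^ s)
    have hscale : {x : ℝ | x • planeRotation (Real.pi * j / 2 ^ (s + 1)) ∈ U} ∈ 𝓝 r :=
      (Continuous.continuousAt
        (f := fun x : ℝ => x • planeRotation (Real.pi * j / 2 ^ (s + 1)))
        (by fun_prop)).eventually (hUo.mem_nhds hs2)
    -- Raising l by multiples of 2^(s+2), a period of the rotation, changes only the scale; the
    -- irrationality of log 2 / log 3 then brings the scale near r.
    obtain ⟨a, m, ham⟩ := exists_two_pow_mul_inv_three_pow_mem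
      (C := 2 * (3⁻¹ : ℝ) ^ (k + 1 + (l + 1))) (by positivity)
      (Q := 2 ^ (s + 2)) (by positivity) hr hscale
    refine ⟨Real.pi * p / 2 ^ (s + 1), hs1, ?_⟩
    simp only [O, Set.mem_iUnion]
    refine ⟨a, k, l + 2 ^ (s + 2) * m, ?_⟩
    have e1 := planeRotation_dyadic_eq hk
    have hl' : ((l + 2 ^ (s + 2) * m + 1 : ℕ) : ℤ) * p = (j - 2 ^ s) + (d + m * p) * 2 ^ (s + 1 + 1) := by
      push_cast at hl ⊢
      linear_combination hl
    have e2 := planeRotation_dyadic_eq hl'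
    have e3 : Real.pi * ((2 ^ s : ℤ) : ℝ) / 2 ^ (s + 1) = Real.pi / 2 := by
      push_cast; rw [pow_succ]; field_simp
    have e4 : Real.pi * ((j - 2 ^ s : ℤ) : ℝ) / 2 ^ (s + 1) =
        -(Real.pi / 2) + Real.pi * j / 2 ^ (s + 1) := by
      push_cast; rw [pow_succ]; field_simp; ring
    rw [e3] at e1
    rw [e4, ← planeRotation_mul] at e2
    have : W a k (l + 2 ^ (s + 2) * m) (Real.pi * p / 2 ^ (s + 1)) =
        (2 * (3⁻¹ : ℝ) ^ (k + 1 + (l + 1)) * (2 ^ a * (3⁻¹ : ℝ) ^ (2 ^ (s + 2) * m))) •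
          planeRotation (Real.pi * j / 2 ^ (s + 1)) := by
      have hD := diagonal_mul_quarter_turn_conj (2 ^ (a + 1))
      simp only [hW, smul_pow, planeRotation_pow, e1, e2, diagonal_fin_two_pow, one_pow,
        Matrix.mul_smul, Matrix.smul_mul, ← Matrix.mul_assoc, hD, smul_smul, Matrix.one_mul]
      congr 1
      ring
    rw [Set.mem_preimage, this]
    exact ham
  -- Baire's theorem: countably many dense open conditions on θ hold at once.
  obtain ⟨θ, hθ⟩ := (dense_biInter_of_isOpen hO hcount hdense).nonempty
  refine ⟨θ, fun r φ hr => hb.mem_closure_iff.2 fun U hU hmem => ?_⟩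
  have h1 := Set.mem_iInter₂.1 hθ U ⟨hU, r, φ, hr, hmem⟩
  simp only [O, Set.mem_iUnion] at h1
  obtain ⟨a, k, l, h⟩ := h1
  refine ⟨_, h, ?_⟩
  have hA := Subsemigroup.subset_closure (s := {diagonal ![2, 1], (3⁻¹ : ℝ) • planeRotation θ})
    (Set.mem_insert _ _)
  have hB := Subsemigroup.subset_closure (s := {diagonal ![2, 1], (3⁻¹ : ℝ) • planeRotation θ})
    (Set.mem_insert_of_mem _ (Set.mem_singleton _))
  have hA' := Subsemigroup.pow_succ_mem _ hA a
  exact Subsemigroup.mul_mem _ (Subsemigroup.mul_mem _ (Subsemigroup.mul_mem _ hA'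
    (Subsemigroup.pow_succ_mem _ hB k)) hA') (Subsemigroup.pow_succ_mem _ hB l)

/-! ### From similarities to planar transvections and dilations -/

/-- A closed semigroup of planar matrices which contains `diag(2, 1)` and all similarities that
preserve orientation contains all transvections and `diag(x, 1)` for all `x > 0`. -/
theorem transvection_mem_of_similarities_mem {S : Subsemigroup (Matrix (Fin 2) (Fin 2) ℝ)}
    (hS : IsClosed (S : Set (Matrix (Fin 2) (Fin 2) ℝ))) (hD : diagonal ![2, 1] ∈ S)
    (hR : ∀ r φ : ℝ, 0 < r → r • planeRotation φ ∈ S) (x : ℝ) :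
    !![1, x; 0, 1] ∈ S ∧ !![1, 0; x, 1] ∈ S := by
  have hR1 : ∀ φ, planeRotation φ ∈ S := fun φ => by simpa using hR 1 φ one_pos
  have hJ : !![0, -1; 1, 0] ∈ S := planeRotation_pi_div_two ▸ hR1 _
  have hJ' : !![0, 1; -1, 0] ∈ S := planeRotation_neg_pi_div_two ▸ hR1 _
  have hD' : diagonal ![2⁻¹, 1] ∈ S := by
    have h := S.mul_mem (hR 2⁻¹ (Real.pi / 2) (by norm_num)) (S.mul_mem hD hJ')
    convert! h using 1
    rw [planeRotation_pi_div_two]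
    ext i j
    fin_cases i <;> fin_cases j <;> simp [Matrix.mul_apply, Fin.sum_univ_two]
  have hU : ∀ x : ℝ, !![1, x; 0, 1] ∈ S := by
    intro x
    -- These are the conjugates D^(k+1) R(-x / 2^(k+1)) D^(-(k+1)): one off-diagonal entry is
    -- stretched to a finite limit, the other vanishes.
    have hlim : Tendsto (fun k : ℕ => (!![Real.cos (x / 2 ^ (k + 1)), 2 ^ (k + 1) * Real.sin (x / 2 ^ (k + 1));
        -(2⁻¹ ^ (k + 1) * Real.sin (x / 2 ^ (k + 1))), Real.cos (x / 2 ^ (k + 1))] :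
          Matrix (Fin 2) (Fin 2) ℝ)) atTop (𝓝 !![1, x; 0, 1]) := by
      have hh : Tendsto (fun k : ℕ => (2⁻¹ : ℝ) ^ (k + 1)) atTop (𝓝 0) :=
        (tendsto_add_atTop_iff_nat 1).2
          (tendsto_pow_atTop_nhds_zero_of_lt_one (by norm_num) (by norm_num))
      have hx : Tendsto (fun k : ℕ => x / 2 ^ (k + 1)) atTop (𝓝 0) := by
        simpa [div_eq_mul_inv] using hh.const_mul x
      have hcos := (Real.continuous_cos.tendsto 0).comp hx
      have hsin := (Real.continuous_sin.tendsto 0).comp hx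
      rw [Real.cos_zero] at hcos
      rw [Real.sin_zero] at hsin
      have hsinc : Tendsto (fun k : ℕ => 2 ^ (k + 1) * Real.sin (x / 2 ^ (k + 1))) atTop (𝓝 x) := by
        have := ((Real.continuous_sinc.tendsto 0).comp hx).const_mul x
        rw [Real.sinc_zero, mul_one] at this
        refine this.congr fun k => ?_
        rcases eq_or_ne x 0 with rfl | h0
        · simp
        · rw [Function.comp_apply, Real.sinc_of_ne_zero (by positivity)]
          field_simp
      refine tendsto_pi_nhds.2 fun i => tendsto_pi_nhds.2 fun j => ?_
      fin_cases i <;> fin_cases j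
      · simpa [Function.comp_def] using hcos
      · simpa using hsinc
      · simpa using (hh.mul hsin).neg
      · simpa [Function.comp_def] using hcos
    refine hS.mem_of_tendsto hlim (Eventually.of_forall fun k => ?_)
    have h := S.mul_mem (S.mul_mem (S.pow_succ_mem hD k) (hR1 (-(x / 2 ^ (k + 1)))))
      (S.pow_succ_mem hD' k)
    convert! h using 1
    rw [diagonal_fin_two_pow, diagonal_fin_two_pow]
    ext i j
    fin_cases i <;> fin_cases j <;>
      simp [planeRotation] <;> field_simp
  refine ⟨hU x, ?_⟩
  convert! S.mul_mem (S.mul_mem hJ (hU (-x))) hJ' using 1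
  ext i j
  fin_cases i <;> fin_cases j <;> simp [Matrix.mul_apply, Fin.sum_univ_two]

/-- With t = √x, three transvections give the matrix with off-diagonal entries t and -1/t;
multiplying by t times a quarter turn leaves diag(t², 1). -/
theorem diagonal_mem_of_similarities_mem {S : Subsemigroup (Matrix (Fin 2) (Fin 2) ℝ)}
    (hS : IsClosed (S : Set (Matrix (Fin 2) (Fin 2) ℝ))) (hD : diagonal ![2, 1] ∈ S)
    (hR : ∀ r φ : ℝ, 0 < r → r • planeRotation φ ∈ S) {x : ℝ} (hx : 0 < x) :
    diagonal ![x, 1] ∈ S := by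
  have hT := transvection_mem_of_similarities_mem hS hD hR
  have ht : 0 < √x := Real.sqrt_pos.2 hx
  have h := S.mul_mem (S.mul_mem (S.mul_mem (hT (√x)).1 (hT (-(√x)⁻¹)).2) (hT (√x)).1)
    (hR (√x) (Real.pi / 2) ht)
  convert! h using 1
  rw [planeRotation_pi_div_two]
  have hsq : √x * √x = x := Real.mul_self_sqrt hx.le
  ext i j
  fin_cases i <;> fin_cases j <;>
    simp [Matrix.mul_apply, Fin.sum_univ_two, ht.ne', hsq]

/-! ### Generating all matrices from transvections -/

section Generation

variable {ι : Type*} [Fintype ι] [DecidableEq ι]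

theorem transvection_apply_same (i j b : ι) (c : ℝ) :
    transvection i j c i b = (1 : Matrix ι ι ℝ) i b + c * (1 : Matrix ι ι ℝ) j b := by
  rw [← Matrix.mul_one (transvection i j c), transvection_mul_apply_same]

theorem transvection_apply_of_ne {i j a b : ι} (ha : a ≠ i) (c : ℝ) :
    transvection i j c a b = (1 : Matrix ι ι ℝ) a b := by
  rw [← Matrix.mul_one (transvection i j c), transvection_mul_apply_of_ne _ _ _ _ ha]

theorem transvection_commutator {i j k : ι} (hij : i ≠ j) (hik : i ≠ k) (hjk : j ≠ k) (x : ℝ) :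
    transvection i j x * transvection j k 1 * transvection i j (-x) * transvection j k (-1) =
      transvection i k x := by
  ext a b
  simp only [Matrix.mul_assoc]
  by_cases ha : a = i
  · subst ha
    simp [hij, hij.symm, hik.symm, hjk.symm, transvection_apply_same, transvection_apply_of_ne]
    ring
  · by_cases ha' : a = j
    · subst ha'
      simp [hij.symm, hik.symm, hjk.symm, transvection_apply_same, transvection_apply_of_ne]
    · simp [ha, ha', transvection_apply_of_ne]

/-- Product of two Weyl elements, with parameters x and -1. It moves a diagonal factor from one
coordinate to another. -/
theorem transvection_torus {i j : ι} (hij : i ≠ j) {x : ℝ} (hx : x ≠ 0) :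
    transvection i j x * transvection j i (-x⁻¹) * transvection i j x *
      (transvection i j (-1) * transvection j i 1 * transvection i j (-1)) =
      diagonal (Function.update (Function.update 1 i x) j x⁻¹) := by
  ext a b
  simp only [Matrix.mul_assoc]
  by_cases ha : a = i
  · subst ha
    simp [hij, hij.symm, transvection_apply_same, transvection_apply_of_ne, diagonal_apply]
    by_cases hb : a = b
    · subst hb
      simp [one_apply, hij.symm, hx]
    · by_cases hb' : j = b
      · subst hb'
        simp [one_apply, hij, hx]
      · simp [one_apply, hb, hb']
  · by_cases ha' : a = j
    · subst ha'
      simp [hij, hij.symm, transvection_apply_same, transvection_apply_of_ne, diagonal_apply]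
      by_cases hb : a = b
      · subst hb
        simp [one_apply, hij]
      · simp [one_apply, hb, hx]
    · simp [ha, ha', transvection_apply_of_ne, diagonal_apply, one_apply]

theorem swap_mul_transvections {i j : ι} (hij : i ≠ j) :
    swap ℝ i j * (transvection i j 1 * transvection j i (-1) * transvection i j 1) =
      diagonal (Function.update 1 i (-1)) := by
  ext a b
  simp only [Matrix.mul_assoc]
  by_cases ha : a = i
  · subst ha
    simp [hij.symm, transvection_apply_same, transvection_apply_of_ne, diagonal_apply, one_apply]
    split_ifs <;> simp
  · by_cases ha' : a = j
    · subst ha'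
      simp [hij, hij.symm, transvection_apply_same, transvection_apply_of_ne, diagonal_apply,
        one_apply]
    · rw [swap_mul_of_ne ha ha']
      simp [ha, ha', transvection_apply_of_ne, diagonal_apply, one_apply]

/-- Commutators through the hub `i₀` produce the remaining pairs. -/
theorem transvection_mem_of_star {S : Subsemigroup (Matrix ι ι ℝ)} (i₀ : ι)
    (hT : ∀ j, j ≠ i₀ → ∀ x, transvection i₀ j x ∈ S ∧ transvection j i₀ x ∈ S)
    {i j : ι} (hij : i ≠ j) (x : ℝ) : transvection i j x ∈ S := by
  rcases eq_or_ne i i₀ with rfl | hi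
  · exact (hT j hij.symm x).1
  rcases eq_or_ne j i₀ with rfl | hj
  · exact (hT i hij x).2
  rw [← transvection_commutator hi hij hj.symm]
  exact S.mul_mem (S.mul_mem (S.mul_mem (hT i hi _).2 (hT j hj _).1) (hT i hi _).2) (hT j hj _).1

/-- A closed semigroup of real matrices is everything as soon as it contains all transvections,
the matrices `diag(x, 1, …, 1)` for `x > 0`, and a reflection `diag(1, …, -1, …, 1)`. -/
theorem mem_of_transvection_mem {S : Subsemigroup (Matrix ι ι ℝ)}
    (hS : IsClosed (S : Set (Matrix ι ι ℝ)))
    (hT : ∀ i j, i ≠ j → ∀ x, transvection i j x ∈ S) (i₀ : ι)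
    (hD : ∀ x : ℝ, 0 < x → diagonal (Function.update 1 i₀ x) ∈ S) (j₀ : ι)
    (hneg : diagonal (Function.update 1 j₀ (-1 : ℝ)) ∈ S) (M : Matrix ι ι ℝ) : M ∈ S := by
  have transfer : ∀ i j (x : ℝ), x ≠ 0 → diagonal (Function.update 1 j x) ∈ S →
      diagonal (Function.update 1 i x) ∈ S := by
    intro i j x hx h
    rcases eq_or_ne i j with rfl | hij
    · exact h
    have ht : diagonal (Function.update (Function.update 1 i x) j x⁻¹) ∈ S := by
      rw [← transvection_torus hij hx]
      exact S.mul_mem (S.mul_mem (S.mul_mem (hT _ _ hij _) (hT _ _ hij.symm _)) (hT _ _ hij _))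
        (S.mul_mem (S.mul_mem (hT _ _ hij _) (hT _ _ hij.symm _)) (hT _ _ hij _))
    convert! S.mul_mem ht h using 1
    rw [diagonal_mul_diagonal]
    congr 1
    ext a
    by_cases ha : a = j
    · subst ha; simp [hij.symm, hx]
    · by_cases ha' : a = i
      · subst ha'; simp [ha]
      · simp [ha, ha']
  have hpos : ∀ i (x : ℝ), 0 < x → diagonal (Function.update 1 i x) ∈ S :=
    fun i x hx => transfer i i₀ x hx.ne' (hD x hx)
  have hall : ∀ i (x : ℝ), diagonal (Function.update 1 i x) ∈ S := by
    intro i x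
    rcases lt_trichotomy x 0 with hx | rfl | hx
    · convert! S.mul_mem (transfer i j₀ (-1) (by norm_num) hneg) (hpos i (-x) (by linarith)) using 1
      rw [diagonal_mul_diagonal]
      congr 1
      ext a
      by_cases ha : a = i
      · subst ha; simp
      · simp [ha]
    -- Singular matrices enter as limits, through closedness.
    · have hc : Tendsto (fun x : ℝ => diagonal (Function.update (1 : ι → ℝ) i x)) (𝓝[>] 0)
          (𝓝 (diagonal (Function.update 1 i 0))) :=
        ((Continuous.matrix_diagonal (by fun_prop)).tendsto 0).mono_left nhdsWithin_le_nhds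
      exact hS.mem_of_tendsto hc (eventually_mem_nhdsWithin.mono fun x hx => hpos i x hx)
    · exact hpos i x hx
  have hone : (1 : Matrix ι ι ℝ) ∈ S := by simpa using hall i₀ 1
  have hdiag : ∀ d : ι → ℝ, diagonal d ∈ S := by
    intro d
    have h : ∀ s : Finset ι, diagonal (fun i => if i ∈ s then d i else 1) ∈ S := by
      intro s
      induction s using Finset.induction_on with
      | empty => simpa using hone
      | insert i s hi ih =>
        convert! S.mul_mem (hall i (d i)) ih using 1
        rw [diagonal_mul_diagonal]
        congr 1
        ext a
        by_cases ha : a = i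
        · subst ha; simp [hi]
        · simp [ha]
    simpa using h Finset.univ
  exact diagonal_transvection_induction (· ∈ S) M (fun d _ => hdiag d)
    (fun t => hT t.i t.j t.hij t.c) (fun _ _ => S.mul_mem)

end Generation

/-! ### Transfer to larger monoids, and dimension two -/

/-- For a suitable angle, a closed semigroup that contains the images of `diag(2, 1)` and of the scaled
rotation also contains the images of all similarities, transvections and dilations of the plane. -/
theorem exists_angle_mem_comap {M : Type*} [Monoid M] [TopologicalSpace M] :
    ∃ θ : ℝ, ∀ (f : Matrix (Fin 2) (Fin 2) ℝ →* M) (S : Subsemigroup M), Continuous f →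
      IsClosed (S : Set M) → f (diagonal ![2, 1]) ∈ S → f ((3⁻¹ : ℝ) • planeRotation θ) ∈ S →
      (∀ r φ : ℝ, 0 < r → f (r • planeRotation φ) ∈ S) ∧
      (∀ x : ℝ, f !![1, x; 0, 1] ∈ S ∧ f !![1, 0; x, 1] ∈ S) ∧
      (∀ x : ℝ, 0 < x → f (diagonal ![x, 1]) ∈ S) := by
  obtain ⟨θ, hθ⟩ := exists_angle_similarities_mem_closure
  refine ⟨θ, fun f S hf hS hD hB => ?_⟩
  let T : Subsemigroup (Matrix (Fin 2) (Fin 2) ℝ) := S.comap (f : Matrix (Fin 2) (Fin 2) ℝ →ₙ* M)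
  have hT : IsClosed (T : Set (Matrix (Fin 2) (Fin 2) ℝ)) := hS.preimage hf
  have hle : Subsemigroup.closure {diagonal ![2, 1], (3⁻¹ : ℝ) • planeRotation θ} ≤ T := by
    rw [Subsemigroup.closure_le]
    rintro X (rfl | rfl)
    · exact hD
    · exact hB
  have hR : ∀ r φ : ℝ, 0 < r → r • planeRotation φ ∈ T := fun r φ hr =>
    closure_minimal hle hT (hθ r φ hr)
  exact ⟨hR, transvection_mem_of_similarities_mem hT hD hR,
    fun x hx => diagonal_mem_of_similarities_mem hT hD hR hx⟩

theorem dense_subsemigroup_of_forall_mem {M : Type*} [Semigroup M] [TopologicalSpace M]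
    [ContinuousMul M] (S : Subsemigroup M) (h : ∀ x, x ∈ S.topologicalClosure) :
    Dense (S : Set M) := h

theorem exists_dense_pair_fin_two : ∃ A B : Matrix (Fin 2) (Fin 2) ℝ,
    Dense (Subsemigroup.closure {A, B} : Set (Matrix (Fin 2) (Fin 2) ℝ)) := by
  obtain ⟨θ, hθ⟩ := exists_angle_mem_comap (M := Matrix (Fin 2) (Fin 2) ℝ)
  -- The square is diag(2, 1); cancelling √2 later leaves the reflection.
  refine ⟨diagonal ![√2, -1], (3⁻¹ : ℝ) • planeRotation θ, ?_⟩
  set S₀ := Subsemigroup.closure {diagonal ![√2, -1], (3⁻¹ : ℝ) • planeRotation θ}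
  set S := S₀.topologicalClosure
  have hS : IsClosed (S : Set (Matrix (Fin 2) (Fin 2) ℝ)) := S₀.isClosed_topologicalClosure
  have hA : diagonal ![√2, -1] ∈ S :=
    S₀.le_topologicalClosure (Subsemigroup.subset_closure (by simp))
  have hB : (3⁻¹ : ℝ) • planeRotation θ ∈ S :=
    S₀.le_topologicalClosure (Subsemigroup.subset_closure (by simp))
  have hA2 : diagonal ![2, 1] ∈ S := by
    convert! S.mul_mem hA hA using 1
    rw [diagonal_mul_diagonal]
    congr 1
    ext i
    fin_cases i <;> simp
  obtain ⟨-, hT, hD⟩ := hθ (MonoidHom.id _) S continuous_id hS hA2 hB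
  simp only [MonoidHom.id_apply] at hT hD
  have hT' : ∀ i j, i ≠ j → ∀ x : ℝ, transvection i j x ∈ S := by
    intro i j hij x
    fin_cases i <;> fin_cases j
    · exact absurd rfl hij
    · convert! (hT x).1 using 1
      ext a b
      fin_cases a <;> fin_cases b <;> simp [transvection]
    · convert! (hT x).2 using 1
      ext a b
      fin_cases a <;> fin_cases b <;> simp [transvection]
    · exact absurd rfl hij
  refine dense_subsemigroup_of_forall_mem _
    (mem_of_transvection_mem hS hT' 0 (fun x hx => ?_) 1 ?_)
  · convert! hD x hx using 1
    congr 1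
    ext i
    fin_cases i <;> simp
  · convert! S.mul_mem (hD (√2)⁻¹ (by positivity)) hA using 1
    rw [diagonal_mul_diagonal]
    congr 1
    ext i
    fin_cases i <;> simp

/-! ### Conjugation by permutation matrices -/

theorem transvection_submatrix_perm {ι : Type*} [DecidableEq ι] (σ : Equiv.Perm ι) (i j : ι) (c : ℝ) :
    (transvection (σ i) (σ j) c).submatrix σ σ = transvection i j c := by
  ext a b
  simp [transvection, one_apply, single_apply]

section Permutation

variable {ι : Type*} [Fintype ι] [DecidableEq ι]

theorem permMatrix_mul_eq_submatrix_mul (σ : Equiv.Perm ι) (M : Matrix ι ι ℝ) :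
    σ.permMatrix ℝ * M = M.submatrix σ σ * σ.permMatrix ℝ := by
  rw [PEquiv.toMatrix_toPEquiv_mul, PEquiv.mul_toMatrix_toPEquiv]
  ext i j
  simp

/-- The permutations whose matrices lie in a given multiplicative submonoid. -/
def permSubmonoid (S : Submonoid (Matrix ι ι ℝ)) : Submonoid (Equiv.Perm ι) :=
  S.comap permMatrixHom

/-- In a finite group every element is a power of its inverse, so no inverses need to be assumed.
`permMatrixHom` itself inverts, hence the double inverse. -/
theorem permMatrix_inv_mem {S : Submonoid (Matrix ι ι ℝ)} {σ : Equiv.Perm ι}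
    (h : σ.permMatrix ℝ ∈ S) : σ⁻¹.permMatrix ℝ ∈ S := by
  have h1 : σ⁻¹ ∈ permSubmonoid S := by
    change (σ⁻¹)⁻¹.permMatrix ℝ ∈ S
    rwa [inv_inv]
  have h2 : Submonoid.powers σ⁻¹ ≤ permSubmonoid S := by
    rwa [Submonoid.powers_le]
  have h3 : σ ∈ Submonoid.powers σ⁻¹ := by
    rw [mem_powers_iff_mem_zpowers, ← Subgroup.inv_mem_iff]
    exact Subgroup.mem_zpowers _
  exact h2 h3

theorem transvection_perm_mem {S : Submonoid (Matrix ι ι ℝ)} {σ : Equiv.Perm ι}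
    (h : σ.permMatrix ℝ ∈ S) {i j : ι} {c : ℝ} (ht : transvection i j c ∈ S) :
    transvection (σ i) (σ j) c ∈ S := by
  have h1 := permMatrix_mul_eq_submatrix_mul σ (transvection (σ i) (σ j) c)
  rw [transvection_submatrix_perm] at h1
  have h2 : σ⁻¹.permMatrix ℝ * σ.permMatrix ℝ = 1 := by
    rw [← permMatrix_mul, mul_inv_cancel, permMatrix_one]
  have h3 : transvection (σ i) (σ j) c =
      σ⁻¹.permMatrix ℝ * transvection i j c * σ.permMatrix ℝ := by
    rw [Matrix.mul_assoc, ← h1, ← Matrix.mul_assoc, h2, Matrix.one_mul]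
  rw [h3]
  exact S.mul_mem (S.mul_mem (permMatrix_inv_mem h) ht) h

end Permutation

/-! ### The dense pair in dimension at least three -/

/-- Planar matrices acting on the first two coordinates and fixing the others. -/
noncomputable def planeEmbedding (κ : Type*) [Fintype κ] [DecidableEq κ] :
    Matrix (Fin 2) (Fin 2) ℝ →* Matrix (Fin 2 ⊕ κ) (Fin 2 ⊕ κ) ℝ where
  toFun X := fromBlocks X 0 0 1
  map_one' := fromBlocks_one
  map_mul' X Y := by simp [fromBlocks_multiply]

section Embedding

variable {κ : Type*} [Fintype κ] [DecidableEq κ]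

theorem planeEmbedding_apply (X : Matrix (Fin 2) (Fin 2) ℝ) :
    planeEmbedding κ X = fromBlocks X 0 0 1 := rfl

theorem continuous_planeEmbedding : Continuous (planeEmbedding κ) :=
  Continuous.matrix_fromBlocks continuous_id continuous_const continuous_const continuous_const

theorem planeEmbedding_upper (x : ℝ) :
    planeEmbedding κ !![1, x; 0, 1] = transvection (Sum.inl 0) (Sum.inl 1) x := by
  ext (a | a) (b | b)
  · fin_cases a <;> fin_cases b <;> simp [planeEmbedding_apply, transvection]
  all_goals simp [planeEmbedding_apply, transvection, one_apply]

theorem planeEmbedding_lower (x : ℝ) :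
    planeEmbedding κ !![1, 0; x, 1] = transvection (Sum.inl 1) (Sum.inl 0) x := by
  ext (a | a) (b | b)
  · fin_cases a <;> fin_cases b <;> simp [planeEmbedding_apply, transvection]
  all_goals simp [planeEmbedding_apply, transvection, one_apply]

theorem planeEmbedding_diagonal (x : ℝ) :
    planeEmbedding κ (diagonal ![x, 1]) = diagonal (Function.update 1 (Sum.inl 0) x) := by
  ext (a | a) (b | b)
  · fin_cases a <;> fin_cases b <;> simp [planeEmbedding_apply]
  all_goals simp [planeEmbedding_apply, one_apply, diagonal_apply]

end Embedding

/-- The permutation which fixes the first two coordinates and rotates the others. -/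
def tailRotation (m : ℕ) : Equiv.Perm (Fin 2 ⊕ Fin (m + 1)) :=
  Equiv.sumCongr (Equiv.refl _) (finRotate (m + 1))

theorem tailRotation_pow_inl (m k : ℕ) (i : Fin 2) :
    (tailRotation m ^ k) (Sum.inl i) = Sum.inl i := by
  induction k with
  | zero => rfl
  | succ k ih => rw [pow_succ', Equiv.Perm.mul_apply, ih]; rfl

theorem tailRotation_pow_inr_zero (m k : ℕ) :
    (tailRotation m ^ k) (Sum.inr 0) = Sum.inr (Fin.ofNat (m + 1) k) := by
  induction k with
  | zero => rfl
  | succ k ih =>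
    rw [pow_succ', Equiv.Perm.mul_apply, ih]
    simp only [tailRotation, Equiv.sumCongr_apply, Sum.map_inr, finRotate_apply]
    congr 1
    ext
    simp [Fin.val_add]

theorem commute_tailRotation_planeEmbedding (m : ℕ) (X : Matrix (Fin 2) (Fin 2) ℝ) :
    Commute (planeEmbedding (Fin (m + 1)) X) ((tailRotation m).permMatrix ℝ) := by
  have h := permMatrix_mul_eq_submatrix_mul (tailRotation m) (planeEmbedding (Fin (m + 1)) X)
  have h' : (planeEmbedding (Fin (m + 1)) X).submatrix (tailRotation m) (tailRotation m) =
      planeEmbedding (Fin (m + 1)) X := by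
    ext (a | a) (b | b) <;> simp [tailRotation, planeEmbedding_apply, one_apply]
  rw [h'] at h
  exact h.symm

/-- The matrix `diag(z, 1, …, 1)` composed with the exchange of the second and the third
coordinate. -/
noncomputable def dilationSwap (z : ℝ) (m : ℕ) :
    Matrix (Fin 2 ⊕ Fin (m + 1)) (Fin 2 ⊕ Fin (m + 1)) ℝ :=
  planeEmbedding _ (diagonal ![z, 1]) * swap ℝ (Sum.inl 1) (Sum.inr 0)

theorem commute_planeEmbedding_diagonal_swap (z : ℝ) (m : ℕ) :
    Commute (planeEmbedding (Fin (m + 1)) (diagonal ![z, 1]))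
      (swap ℝ (Sum.inl 1) (Sum.inr 0)) := by
  have h := permMatrix_mul_eq_submatrix_mul (Equiv.swap (Sum.inl 1) (Sum.inr 0))
    (planeEmbedding (Fin (m + 1)) (diagonal ![z, 1]))
  rw [planeEmbedding_diagonal, submatrix_diagonal_equiv] at h
  rw [planeEmbedding_diagonal]
  refine Eq.trans ?_ h.symm
  congr 2
  ext a
  by_cases ha : a = Sum.inl 0
  · subst ha
    rw [Function.comp_apply, Equiv.swap_apply_of_ne_of_ne (by simp) (by simp)]
  · have : Equiv.swap (Sum.inl 1) (Sum.inr (0 : Fin (m + 1))) a ≠ Sum.inl 0 := by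
      rw [Ne, Equiv.swap_apply_eq_iff, Equiv.swap_apply_of_ne_of_ne (by simp) (by simp)]
      exact ha
    simp [ha, this]

theorem dilationSwap_mul_self {z : ℝ} (m : ℕ) :
    dilationSwap z m * dilationSwap z m = planeEmbedding _ (diagonal ![z * z, 1]) := by
  have h := (commute_planeEmbedding_diagonal_swap z m).eq
  rw [dilationSwap, Matrix.mul_assoc, ← Matrix.mul_assoc (swap _ _ _), ← h, Matrix.mul_assoc,
    Matrix.swap_mul_self, Matrix.mul_one, ← map_mul, diagonal_mul_diagonal]
  congr 2
  ext i
  fin_cases i <;> simp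

theorem exists_dense_pair_dilationSwap (m : ℕ) :
    ∃ B, Dense (Subsemigroup.closure {dilationSwap √2 m, B} :
      Set (Matrix (Fin 2 ⊕ Fin (m + 1)) (Fin 2 ⊕ Fin (m + 1)) ℝ)) := by
  obtain ⟨θ, hθ⟩ := exists_angle_mem_comap
    (M := Matrix (Fin 2 ⊕ Fin (m + 1)) (Fin 2 ⊕ Fin (m + 1)) ℝ)
  set ρ := tailRotation m with hρ
  have hN : 0 < orderOf ρ := orderOf_pos ρ
  have hN' : (orderOf ρ : ℝ) ≠ 0 := by exact_mod_cast hN.ne'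
  -- An N-th root of (1/3) R(θ), N being the order of the tail rotation: in B^N the permutation
  -- disappears and the planar generator remains.
  set X : Matrix (Fin 2) (Fin 2) ℝ :=
    ((3⁻¹ : ℝ) ^ ((orderOf ρ : ℝ)⁻¹)) • planeRotation (θ / orderOf ρ) with hX
  have hXpow : X ^ orderOf ρ = (3⁻¹ : ℝ) • planeRotation θ := by
    rw [hX, smul_pow, planeRotation_pow, mul_div_cancel₀ _ hN',
      Real.rpow_inv_natCast_pow (by norm_num) hN.ne']
  set B := planeEmbedding (Fin (m + 1)) X * ρ.permMatrix ℝ with hBdef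
  refine ⟨B, ?_⟩
  set S₀ := Subsemigroup.closure {dilationSwap √2 m, B}
  set S := S₀.topologicalClosure
  have hS : IsClosed (S : Set (Matrix (Fin 2 ⊕ Fin (m + 1)) (Fin 2 ⊕ Fin (m + 1)) ℝ)) :=
    S₀.isClosed_topologicalClosure
  have hA : dilationSwap √2 m ∈ S :=
    S₀.le_topologicalClosure (Subsemigroup.subset_closure (by simp))
  have hB : B ∈ S := S₀.le_topologicalClosure (Subsemigroup.subset_closure (by simp))
  have hA2 : planeEmbedding _ (diagonal ![2, 1]) ∈ S := by
    simpa [dilationSwap_mul_self] using S.mul_mem hA hA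
  have hpow (k : ℕ) : (ρ.permMatrix ℝ) ^ k = (ρ ^ k).permMatrix ℝ := by
    induction k with
    | zero => simp
    | succ k ih => rw [pow_succ, ih, pow_succ', permMatrix_mul]
  have hBN : planeEmbedding (Fin (m + 1)) ((3⁻¹ : ℝ) • planeRotation θ) ∈ S := by
    obtain ⟨k, hk⟩ := Nat.exists_eq_add_of_le' hN
    have h := S.pow_succ_mem hB k
    rw [← hk, hBdef, (commute_tailRotation_planeEmbedding m X).mul_pow, ← map_pow, hXpow, hpow,
      pow_orderOf_eq_one, permMatrix_one, mul_one] at h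
    exact h
  obtain ⟨hR, hT, hD⟩ := hθ (planeEmbedding _) S continuous_planeEmbedding hS hA2 hBN
  have hone : (1 : Matrix (Fin 2 ⊕ Fin (m + 1)) (Fin 2 ⊕ Fin (m + 1)) ℝ) ∈ S := by
    have := hR 1 0 one_pos
    rwa [planeRotation_zero, one_smul, map_one] at this
  let S' : Submonoid (Matrix (Fin 2 ⊕ Fin (m + 1)) (Fin 2 ⊕ Fin (m + 1)) ℝ) :=
    { S with one_mem' := hone }
  have hswap : (Equiv.swap (Sum.inl 1) (Sum.inr 0) : Equiv.Perm (Fin 2 ⊕ Fin (m + 1))).permMatrix ℝ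
      ∈ S' := by
    have h := S.mul_mem (hD (√2)⁻¹ (by positivity)) hA
    rw [dilationSwap, ← Matrix.mul_assoc, ← map_mul, diagonal_mul_diagonal] at h
    convert! h using 1
    rw [show (diagonal fun i => ![(√2)⁻¹, 1] i * ![√2, 1] i : Matrix (Fin 2) (Fin 2) ℝ) = 1 by
      rw [← diagonal_one]; congr 1; ext i; fin_cases i <;> simp, map_one, Matrix.one_mul]
    rfl
  -- X is a similarity, so its inverse is already available and can be cancelled from B.
  have hrot : ρ.permMatrix ℝ ∈ S' := by
    have hinv := hR ((3⁻¹ : ℝ) ^ ((orderOf ρ : ℝ)⁻¹))⁻¹ (-(θ / orderOf ρ)) (by positivity)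
    have h := S.mul_mem hinv hB
    rw [hBdef, ← Matrix.mul_assoc, ← map_mul, hX, Matrix.smul_mul, Matrix.mul_smul, smul_smul,
      inv_mul_cancel₀ (by positivity), one_smul, planeRotation_mul, neg_add_cancel,
      planeRotation_zero, map_one, Matrix.one_mul] at h
    exact h
  -- These permutations fix the first coordinate and send the second to an arbitrary later one,
  -- giving the star of transvections.
  have hperm (k : ℕ) : (ρ ^ k * Equiv.swap (Sum.inl 1) (Sum.inr 0)).permMatrix ℝ ∈ S' := by
    rw [permMatrix_mul, ← hpow]
    exact S'.mul_mem hswap (S'.pow_mem hrot k)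
  have hfix (k : ℕ) : (ρ ^ k * Equiv.swap (Sum.inl 1) (Sum.inr 0) : Equiv.Perm _) (Sum.inl 0) = Sum.inl 0 := by
    rw [Equiv.Perm.mul_apply, Equiv.swap_apply_of_ne_of_ne (by simp) (by simp),
      tailRotation_pow_inl]
  have hmove (k : ℕ) : (ρ ^ k * Equiv.swap (Sum.inl 1) (Sum.inr 0) : Equiv.Perm _) (Sum.inl 1) =
      Sum.inr (Fin.ofNat (m + 1) k) := by
    rw [Equiv.Perm.mul_apply, Equiv.swap_apply_left, tailRotation_pow_inr_zero]
  have hstar : ∀ j, j ≠ Sum.inl 0 → ∀ x : ℝ,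
      transvection (Sum.inl 0) j x ∈ S ∧ transvection j (Sum.inl 0) x ∈ S := by
    have h1 : ∀ x : ℝ, transvection (Sum.inl 0) (Sum.inl 1) x ∈ S :=
      fun x => planeEmbedding_upper (κ := Fin (m + 1)) x ▸ (hT x).1
    have h2 : ∀ x : ℝ, transvection (Sum.inl 1) (Sum.inl 0) x ∈ S :=
      fun x => planeEmbedding_lower (κ := Fin (m + 1)) x ▸ (hT x).2
    rintro (j | j) hj x
    · obtain rfl : j = 1 := by
        fin_cases j
        · exact absurd rfl hj
        · rfl
      exact ⟨h1 x, h2 x⟩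
    · have h3 : transvection _ _ x ∈ S' := transvection_perm_mem (hperm j) (h1 x)
      have h4 : transvection _ _ x ∈ S' := transvection_perm_mem (hperm j) (h2 x)
      rw [hfix, hmove, Fin.ofNat_val_eq_self] at h3 h4
      exact ⟨h3, h4⟩
  have hT' := fun i j (hij : i ≠ j) x => transvection_mem_of_star (Sum.inl 0) hstar hij x
  refine dense_subsemigroup_of_forall_mem _ (mem_of_transvection_mem hS hT' (Sum.inl 0)
    (fun x hx => planeEmbedding_diagonal (κ := Fin (m + 1)) x ▸ hD x hx) (Sum.inl 1) ?_)
  rw [← swap_mul_transvections (j := Sum.inr 0) (by simp)]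
  exact S.mul_mem hswap (S.mul_mem (S.mul_mem (hT' _ _ (by simp) _) (hT' _ _ (by simp) _))
    (hT' _ _ (by simp) _))

/-! ### Reindexing, and dimension one -/

theorem Dense.subsemigroupClosure_reindex {ι κ : Type*} [Fintype ι] [Fintype κ] [DecidableEq ι]
    [DecidableEq κ] (e : ι ≃ κ) {A B : Matrix ι ι ℝ}
    (h : Dense (Subsemigroup.closure {A, B} : Set (Matrix ι ι ℝ))) :
    Dense (Subsemigroup.closure {reindex e e A, reindex e e B} : Set (Matrix κ κ ℝ)) := by
  let f : Matrix ι ι ℝ →ₙ* Matrix κ κ ℝ :=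
    { toFun := reindex e e, map_mul' := map_mul (reindexAlgEquiv ℝ ℝ e) }
  have hf : Continuous f := continuous_id.matrix_reindex e e
  have hs : Function.Surjective f := (reindex e e).surjective
  have hd := hs.denseRange.dense_image hf h
  have himage : (f '' (Subsemigroup.closure {A, B} : Set (Matrix ι ι ℝ))) =
      Subsemigroup.closure {reindex e e A, reindex e e B} := by
    rw [← Subsemigroup.coe_map, MulHom.map_mclosure, Set.image_pair]
    rfl
  rwa [himage] at hd

theorem exists_dense_pair_fin_one : ∃ A B : Matrix (Fin 1) (Fin 1) ℝ,
    Dense (Subsemigroup.closure {A, B} : Set (Matrix (Fin 1) (Fin 1) ℝ)) := by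
  refine ⟨diagonal fun _ => -2, diagonal fun _ => 3⁻¹, ?_⟩
  set S₀ := Subsemigroup.closure {(diagonal fun _ => -2 : Matrix (Fin 1) (Fin 1) ℝ),
    diagonal fun _ => 3⁻¹}
  set S := S₀.topologicalClosure
  have hS : IsClosed (S : Set (Matrix (Fin 1) (Fin 1) ℝ)) := S₀.isClosed_topologicalClosure
  have hA : (diagonal fun _ => -2 : Matrix (Fin 1) (Fin 1) ℝ) ∈ S :=
    S₀.le_topologicalClosure (Subsemigroup.subset_closure (by simp))
  have hB : (diagonal fun _ => 3⁻¹ : Matrix (Fin 1) (Fin 1) ℝ) ∈ S :=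
    S₀.le_topologicalClosure (Subsemigroup.subset_closure (by simp))
  have hc : Continuous fun x : ℝ => (diagonal fun _ => x : Matrix (Fin 1) (Fin 1) ℝ) := by
    fun_prop
  have hpos : ∀ r : ℝ, 0 < r → (diagonal fun _ => r : Matrix (Fin 1) (Fin 1) ℝ) ∈ S := by
    intro r hr
    by_contra hn
    have hc' : Continuous fun x : ℝ => (diagonal fun _ => x ^ 2 : Matrix (Fin 1) (Fin 1) ℝ) := by
      fun_prop
    -- Approximating √r and squaring makes the exponent of -2 even, which removes the sign.
    obtain ⟨a, l, h⟩ := exists_two_pow_mul_inv_three_pow_mem (C := 2 * 3⁻¹) (by norm_num)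
      (Q := 1) one_pos (Real.sqrt_pos.2 hr)
      ((hS.isOpen_compl.preimage hc').mem_nhds
        (show (diagonal fun _ => √r ^ 2) ∉ S by rwa [Real.sq_sqrt hr.le]))
    apply h
    have hw := S.mul_mem (S.pow_succ_mem hA (2 * a + 1)) (S.pow_succ_mem hB (2 * l + 1))
    rw [diagonal_pow, diagonal_pow, diagonal_mul_diagonal] at hw
    convert! hw using 3
    have h4 : (-2 : ℝ) ^ (2 * a + 1 + 1) = 2 ^ (2 * a + 1 + 1) := Even.neg_pow ⟨a + 1, by ring⟩ 2
    rw [Pi.pow_apply, Pi.pow_apply, h4]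
    ring
  refine dense_subsemigroup_of_forall_mem _ fun M => ?_
  rw [show M = diagonal fun _ => M 0 0 by ext a b; fin_cases a; fin_cases b; simp]
  rcases lt_trichotomy (M 0 0) 0 with hx | hx | hx
  · have h := S.mul_mem hA (hpos (M 0 0 / (-2)) (div_pos_of_neg_of_neg hx (by norm_num)))
    rwa [diagonal_mul_diagonal, mul_div_cancel₀ _ (by norm_num)] at h
  · rw [hx]
    exact hS.mem_of_tendsto ((hc.tendsto 0).mono_left nhdsWithin_le_nhds)
      (eventually_mem_nhdsWithin (s := Set.Ioi (0 : ℝ)).mono hpos)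
  · exact hpos _ hx

/-! ### Diagonalisation and membership in `rotationClass` -/

section Reflection

variable {ι : Type*} [Fintype ι] [DecidableEq ι]

theorem commute_diagonal_transvection {d : ι → ℝ} {i j : ι} (h : d i = d j) (c : ℝ) :
    Commute (diagonal d) (transvection i j c) := by
  have h1 : diagonal d * single i j c = single i j c * diagonal d := by
    ext a b
    rw [diagonal_mul, mul_diagonal]
    by_cases ha : i = a
    · by_cases hb : j = b
      · subst ha hb; rw [h]; ring
      · simp [hb]
    · simp [ha]
  rw [Commute, SemiconjBy, transvection, Matrix.mul_add, Matrix.add_mul, h1]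
  simp

/-- The exchange of two coordinates is diagonalised by a product of two transvections. -/
theorem swap_mul_eq_mul_diagonal {i j : ι} (hij : i ≠ j) :
    swap ℝ i j * (transvection j i (-1) * transvection i j 2⁻¹) =
      transvection j i (-1) * transvection i j 2⁻¹ * diagonal (Function.update 1 i (-1)) := by
  ext a b
  rw [mul_diagonal]
  by_cases ha : a = i
  · subst ha
    simp [hij, hij.symm, transvection_apply_same, transvection_apply_of_ne]
    by_cases hb : b = a
    · subst hb
      simp [hij.symm]
    · by_cases hb' : b = j
      · subst hb'
        simp [hij, hij.symm]; norm_num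
      · simp [hb, Ne.symm hb, Ne.symm hb']
  · by_cases ha' : a = j
    · subst ha'
      simp [hij, hij.symm, transvection_apply_same, transvection_apply_of_ne]
      by_cases hb : b = i
      · subst hb
        simp [hij.symm]
      · by_cases hb' : b = a
        · subst hb'
          simp [hij, hij.symm]; norm_num
        · simp [hb, Ne.symm hb, Ne.symm hb']
    · rw [swap_mul_of_ne ha ha']
      simp [ha, ha', transvection_apply_of_ne]
      by_cases hb : b = i
      · subst hb
        simp [ha]
      · simp [hb]

end Reflection

theorem det_dilationSwap (z : ℝ) (m : ℕ) : (dilationSwap z m).det = -z := by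
  rw [dilationSwap, det_mul, planeEmbedding_apply, det_fromBlocks_zero₂₁, swap, det_permutation,
    Equiv.Perm.sign_swap (by simp)]
  simp

theorem dilationSwap_mulVec (z : ℝ) (m : ℕ) :
    dilationSwap z m *ᵥ Function.update (1 : Fin 2 ⊕ Fin (m + 1) → ℝ) (Sum.inl 0) 0 =
      Function.update (1 : Fin 2 ⊕ Fin (m + 1) → ℝ) (Sum.inl 0) 0 := by
  rw [dilationSwap, ← mulVec_mulVec, swap_mulVec, planeEmbedding_diagonal]
  ext a
  rw [mulVec_diagonal]
  by_cases ha : a = Sum.inl 0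
  · subst ha
    rw [Function.comp_apply, Equiv.swap_apply_of_ne_of_ne (by simp) (by simp)]
    simp
  · have : Equiv.swap (Sum.inl 1) (Sum.inr (0 : Fin (m + 1))) a ≠ Sum.inl 0 := by
      rw [Ne, Equiv.swap_apply_eq_iff, Equiv.swap_apply_of_ne_of_ne (by simp) (by simp)]
      exact ha
    simp [ha, this]

/-- The matrix diagonalising `dilationSwap z m`. -/
noncomputable def dilationSwapBasis (m : ℕ) :
    Matrix (Fin 2 ⊕ Fin (m + 1)) (Fin 2 ⊕ Fin (m + 1)) ℝ :=
  transvection (Sum.inr 0) (Sum.inl 1) (-1) * transvection (Sum.inl 1) (Sum.inr 0) 2⁻¹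

theorem det_dilationSwapBasis (m : ℕ) : (dilationSwapBasis m).det = 1 := by
  rw [dilationSwapBasis, det_mul, det_transvection_of_ne _ _ (by simp),
    det_transvection_of_ne _ _ (by simp), one_mul]

theorem dilationSwap_mul_basis (z : ℝ) (m : ℕ) :
    dilationSwap z m * dilationSwapBasis m = dilationSwapBasis m *
      diagonal (Function.update (Function.update 1 (Sum.inl 0) z) (Sum.inl 1) (-1)) := by
  have h : Commute (diagonal (Function.update 1 (Sum.inl 0) z)) (dilationSwapBasis m) :=
    (commute_diagonal_transvection (by simp) _).mul_right
      (commute_diagonal_transvection (by simp) _)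
  rw [dilationSwap, planeEmbedding_diagonal, Matrix.mul_assoc, dilationSwapBasis,
    swap_mul_eq_mul_diagonal (by simp), ← dilationSwapBasis, ← Matrix.mul_assoc, h.eq,
    Matrix.mul_assoc, diagonal_mul_diagonal]
  congr 2
  ext a
  by_cases ha : a = Sum.inl 1
  · subst ha; simp
  · simp [ha]

/-- The coordinates of `diag(z, 1, …, 1, s)`, with the last one moved to the second place. -/
def blockIndexEquiv (m : ℕ) :
    BlockIndex (fun _ : Fin (m + 1) => MiddleBlock.one) ≃ Fin 2 ⊕ Fin (m + 1) where
  toFun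
    | Sum.inl _ => Sum.inl 0
    | Sum.inr (Sum.inl i) => Sum.inr i.1
    | Sum.inr (Sum.inr _) => Sum.inl 1
  invFun
    | Sum.inl 0 => Sum.inl ()
    | Sum.inl 1 => Sum.inr (Sum.inr ())
    | Sum.inr i => Sum.inr (Sum.inl ⟨i, (0 : Fin 1)⟩)
  left_inv := by
    rintro (_ | ⟨i, j⟩ | _)
    · rfl
    · obtain rfl : j = (0 : Fin 1) := Subsingleton.elim (α := Fin 1) j 0
      rfl
    · rfl
  right_inv := by
    rintro (i | i)
    · fin_cases i <;> rfl
    · rfl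

theorem blockForm_eq_submatrix (m : ℕ) (z s : ℝ) :
    blockForm z (fun _ : Fin (m + 1) => MiddleBlock.one) s =
      (diagonal (Function.update (Function.update 1 (Sum.inl 0) z) (Sum.inl 1) s)).submatrix
        (blockIndexEquiv m) (blockIndexEquiv m) := by
  have h : (blockDiagonal' fun _ : Fin (m + 1) => MiddleBlock.one.toMatrix) = 1 :=
    blockDiagonal'_one
  rw [submatrix_diagonal_equiv, blockForm, h]
  ext (a | a | a) (b | b | b) <;>
    simp [blockIndexEquiv, diagonal_apply, one_apply]

theorem reindex_dilationSwap_mem_rotationClass {n m : ℕ} (e : Fin 2 ⊕ Fin (m + 1) ≃ Fin n) {z : ℝ}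
    (hz : 0 < z) : reindex e e (dilationSwap z m) ∈ rotationClass n := by
  have hdet : (reindex e e (dilationSwap z m)).det = -z := by
    rw [det_reindex_self, det_dilationSwap]
  refine ⟨?_, ⟨m + 1, z, fun _ => MiddleBlock.one, (blockIndexEquiv m).trans e,
    reindex e e (dilationSwapBasis m), hz, ?_, ?_⟩, ?_⟩
  · rw [hdet]; linarith
  · rw [det_reindex_self, det_dilationSwapBasis]; exact isUnit_one
  · have hunit : IsUnit (reindex e e (dilationSwapBasis m)).det := by
      rw [det_reindex_self, det_dilationSwapBasis]; exact isUnit_one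
    have hs : |(reindex e e (dilationSwap z m)).det| / (reindex e e (dilationSwap z m)).det
        = -1 := by
      rw [hdet, abs_neg, abs_of_pos hz, div_neg, div_self hz.ne']
    have hform : reindex ((blockIndexEquiv m).trans e) ((blockIndexEquiv m).trans e)
        (blockForm z (fun _ : Fin (m + 1) => MiddleBlock.one) (-1)) = reindex e e
        (diagonal (Function.update (Function.update 1 (Sum.inl 0) z) (Sum.inl 1) (-1))) := by
      rw [blockForm_eq_submatrix]
      ext a b
      simp only [reindex_apply, submatrix_apply, Equiv.symm_trans_apply,
        Equiv.apply_symm_apply]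
    rw [hs, hform]
    have h := congrArg (reindexAlgEquiv ℝ ℝ e) (dilationSwap_mul_basis z m)
    rw [map_mul, map_mul] at h
    simp only [coe_reindexAlgEquiv] at h
    rw [← h, Matrix.mul_nonsing_inv_cancel_right _ _ hunit]
  -- The fixed vector is (0, 1, …, 1), invariant under the swap and untouched by the dilation.
  · refine Module.End.hasEigenvalue_of_hasEigenvector
      (x := Function.update (1 : Fin 2 ⊕ Fin (m + 1) → ℝ) (Sum.inl 0) 0 ∘ e.symm) ⟨?_, ?_⟩
    · rw [Module.End.mem_eigenspace_iff, toLin'_apply, reindex_apply, one_smul,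
        submatrix_mulVec_equiv]
      rw [Function.comp_assoc]
      simp [dilationSwap_mulVec]
    · intro h0
      have := congrFun h0 (e (Sum.inl 1))
      simp at this

theorem theorem3 (n : ℕ) (hn : 1 ≤ n) :
    (∃ A B : Matrix (Fin n) (Fin n) ℝ,
      Dense (Subsemigroup.closure {A, B} : Set (Matrix (Fin n) (Fin n) ℝ))) ∧
    (3 ≤ n → ∃ A B : Matrix (Fin n) (Fin n) ℝ, A ∈ rotationClass n ∧
      Dense (Subsemigroup.closure {A, B} : Set (Matrix (Fin n) (Fin n) ℝ))) := by
  have hlarge : 3 ≤ n → ∃ A B : Matrix (Fin n) (Fin n) ℝ, A ∈ rotationClass n ∧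
      Dense (Subsemigroup.closure {A, B} : Set (Matrix (Fin n) (Fin n) ℝ)) := by
    intro h3
    obtain ⟨m, rfl⟩ := Nat.exists_eq_add_of_le' h3
    let e : Fin 2 ⊕ Fin (m + 1) ≃ Fin (m + 3) := finSumFinEquiv.trans (finCongr (by omega))
    obtain ⟨B, hB⟩ := exists_dense_pair_dilationSwap m
    exact ⟨_, _, reindex_dilationSwap_mem_rotationClass e (Real.sqrt_pos.2 two_pos),
      hB.subsemigroupClosure_reindex e⟩
  refine ⟨?_, hlarge⟩
  rcases Nat.lt_or_ge n 3 with h | h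
  · interval_cases n
    · exact exists_dense_pair_fin_one
    · exact exists_dense_pair_fin_two
  · obtain ⟨A, B, -, hAB⟩ := hlarge h
    exact ⟨A, B, hAB⟩
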